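/- Call a real symmetric tridiagonal matrix $J$ of order $N+1$ (rows and columns indexed by $0,\dots,N$) with diagonal entries $a_0,\dots,a_N$ and positive off-diagonal entries $b_0,\dots,b_{N-1}$ a Jacobi matrix; it is persymmetric if $a_k=a_{N-k}$ for $0\le k\le N$ and $b_l=b_{N-1-l}$ for $0\le l\le N-1$. Let $\mathbf e_0,\dots,\mathbf e_N$ be the standard basis of $\mathbb C^{N+1}$ and put $x_0(t)=(e^{-itJ}\mathbf e_0,\mathbf e_0)$. We say that $J$ realizes perfect state transfer (PST) at time $T>0$ if $e^{-iTJ}\mathbf e_0=e^{i\phi}\mathbf e_N$ for some $\phi\in\mathbb R$. If there is an earliest PST time $T_0$, we say that $J$ has early state exclusion (ESE) at time $t$ if $0<t<T_0$ and $x_0(t)=0$. **Theorem.** Let $N=2n-1$, where $n>1$ is an integer, and let $m$ be a positive integer. There is a unique persymmetric Jacobi matrix $J$ of order $N+1$ whose eigenvalues $\lambda_0<\lambda_1<\dots<\lambda_N$ satisfy $\lambda_{N-k}=-\lambda_k$ for $0\le k\le N$, $\lambda_n-\lambda_{n-1}=2m+1$, and $\lambda_{k+1}-\lambda_k=1$ for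 $0\le k\le N-1$, $k\ne n-1$. This matrix realizes PST with earliest transfer time $T_0=\pi$, and it has ESE at at least $m$ distinct times: there are distinct $t_1,\dots,t_m\in(0,\pi)$ with $x_0(t_j)=0$ for $j=1,\dots,m$. In particular, for every $n>1$ and $m\ge1$ there is a Jacobi matrix of order $2n$ that realizes PST and has at least $m$ cases of ESE. -/

import Mathlib

/-- A Jacobi matrix of order `N + 1`: a real symmetric tridiagonal matrix whose off-diagonal
entries `b_k = J k (k+1)`, `k = 0, …, N - 1`, are positive. -/
structure IsJacobi {N : ℕ} (J : Matrix (Fin (N + 1)) (Fin (N + 1)) ℝ) : Prop where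
  symm : J.IsSymm
  tridiagonal : ∀ i j : Fin (N + 1), (i : ℕ) + 1 < (j : ℕ) → J i j = 0
  offDiag_pos : ∀ k : Fin N, 0 < J k.castSucc k.succ

/-- Persymmetry: `a_k = a_{N-k}` for `k = 0, …, N` and `b_l = b_{N-1-l}` for `l = 0, …, N-1`. -/
structure IsPersymmetric {N : ℕ} (J : Matrix (Fin (N + 1)) (Fin (N + 1)) ℝ) : Prop where
  diag : ∀ k : Fin (N + 1), J k k = J k.rev k.rev
  offDiag : ∀ l : Fin N, J l.castSucc l.succ = J l.rev.castSucc l.rev.succ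

/-- The evolved state `e^{-itJ} e_0`, a vector in `ℂ^{N+1}`. -/
noncomputable def evolvedState {N : ℕ} (J : Matrix (Fin (N + 1)) (Fin (N + 1)) ℝ) (t : ℝ) :
    Fin (N + 1) → ℂ :=
  Matrix.mulVec (NormedSpace.exp ((-(Complex.I * (t : ℂ))) • J.map Complex.ofReal))
    (Pi.single 0 1)

/-- The amplitude `x_0(t) = (e^{-itJ} e_0, e_0)`, i.e. the `0`-th component of the evolved state. -/
noncomputable def returnAmplitude {N : ℕ} (J : Matrix (Fin (N + 1)) (Fin (N + 1)) ℝ) (t : ℝ) : ℂ :=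
  evolvedState J t 0

/-- `J` realizes perfect state transfer at time `T`:
`T > 0` and `e^{-iTJ} e_0 = e^{iφ} e_N` for some real `φ`. -/
def RealizesPSTAt {N : ℕ} (J : Matrix (Fin (N + 1)) (Fin (N + 1)) ℝ) (T : ℝ) : Prop :=
  0 < T ∧ ∃ φ : ℝ, evolvedState J T =
    Complex.exp (Complex.I * (φ : ℂ)) • (Pi.single (Fin.last N) 1 : Fin (N + 1) → ℂ)

/-- `T₀` is the earliest time of perfect state transfer for `J`. -/
def IsEarliestPST {N : ℕ} (J : Matrix (Fin (N + 1)) (Fin (N + 1)) ℝ) (T₀ : ℝ) : Prop :=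
  IsLeast {T : ℝ | RealizesPSTAt J T} T₀

/-- Early state exclusion at time `t`: `J` has an earliest time `T₀` of perfect state transfer,
`0 < t < T₀`, and `x_0(t) = 0`. -/
def HasESEAt {N : ℕ} (J : Matrix (Fin (N + 1)) (Fin (N + 1)) ℝ) (t : ℝ) : Prop :=
  ∃ T₀ : ℝ, IsEarliestPST J T₀ ∧ 0 < t ∧ t < T₀ ∧ returnAmplitude J t = 0

/-- The eigenvalues `lam 0, …, lam N` of `J` (to be used with `N + 1 = 2 * n`) are symmetric about
`0`, and the consecutive gaps `lam (k+1) - lam k` are all `1`, except the middle one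
`lam n - lam (n-1)`, which is `2 * m + 1`. -/
def HasMiddleGapSpectrum {N : ℕ} (n m : ℕ) (J : Matrix (Fin (N + 1)) (Fin (N + 1)) ℝ) : Prop :=
  ∃ lam : Fin (N + 1) → ℝ,
    spectrum ℝ J = Set.range lam ∧
    (∀ k : Fin (N + 1), lam k.rev = -lam k) ∧
    ∀ k : Fin N, lam k.succ - lam k.castSucc = if (k : ℕ) + 1 = n then 2 * (m : ℝ) + 1 else 1

/-! The prescribed spectrum consists of the half-integers `±(l + 1/2)` with `m ≤ l ≤ m + n - 1`.

Inverse problem: a Jacobi matrix is determined by its moments at `e₀`, hence by its eigenvalues and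
the weights `Q k 0 ^ 2`. Evaluating the polynomial `∏_{l ≠ k} (X - λ_l)` at `J` gives `Q k N * Q k 0
* ∏_{l ≠ k} (λ_k - λ_l) = b_0 ⋯ b_{N-1}`. Under persymmetry both end components have the same
modulus, so the weights are proportional to `1 / |∏_{l ≠ k} (λ_k - λ_l)|` and the spectrum
determines `J`. Conversely, Gram–Schmidt on Krylov vectors produces a matrix with these weights, and
it is persymmetric.

Transfer: the same formula gives `Q k N = (-1)^(N-k) * Q k 0`. All gaps are odd, so the phases `exp
(-iπλ_k)` alternate too, which is PST at `π`. A gap equal to `1` forces `cos T = -1` at any PST time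
`T`, so none is earlier.

Exclusion: by symmetry `x_0(t)` is a positive combination of `cos ((l + 1/2) t)` with `l ≥ m`, that
is `cos (t/2) * P (cos t)`. It is orthogonal to `cos (t/2) * R (cos t)` for every polynomial `R` of
degree below `m`, so `P` must change sign at least `m` times (`exists_zeros_sum_cos_half`). -/

open Matrix

/-! ### Zeros of sums of half-integer cosines (Sturm–Hurwitz) -/

open Polynomial in
/-- A real polynomial has constant sign on an open interval after multiplication by `X - s` for
finitely many of its roots `s` in that interval. -/
theorem exists_roots_mul_prod_constant_sign (a b : ℝ) (d : ℕ) :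
    ∀ P : ℝ[X], P ≠ 0 → P.natDegree = d → ∃ S : Finset ℝ,
      (∀ s ∈ S, s ∈ Set.Ioo a b ∧ P.eval s = 0) ∧
      ((∀ x ∈ Set.Ioo a b, 0 ≤ (P * ∏ s ∈ S, (X - C s)).eval x) ∨
        ∀ x ∈ Set.Ioo a b, (P * ∏ s ∈ S, (X - C s)).eval x ≤ 0) := by
  classical
  induction d with
  | zero =>
    intro P hP hd
    refine ⟨∅, by simp, ?_⟩
    rw [Polynomial.eq_C_of_natDegree_eq_zero hd]
    rcases le_total 0 (P.coeff 0) with h | h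
    · left; intro x _; simpa using h
    · right; intro x _; simpa using h
  | succ d ih =>
    intro P hP hd
    by_cases hr : ∃ r ∈ Set.Ioo a b, P.eval r = 0
    · obtain ⟨r, hrab, hr0⟩ := hr
      obtain ⟨P₁, rfl⟩ := Polynomial.dvd_iff_isRoot.mpr hr0
      have hP₁ : P₁ ≠ 0 := right_ne_zero_of_mul hP
      have hd₁ : P₁.natDegree = d := by
        rw [Polynomial.natDegree_mul (X_sub_C_ne_zero r) hP₁, natDegree_X_sub_C] at hd
        omega
      obtain ⟨S, hS, hsign⟩ := ih P₁ hP₁ hd₁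
      -- `S` collects the roots of odd multiplicity: each extracted factor `X - r` toggles the
      -- membership of `r`.
      by_cases hrS : r ∈ S
      · refine ⟨S.erase r, fun s hs => ⟨(hS s (Finset.mem_of_mem_erase hs)).1, by
          simp [(hS s (Finset.mem_of_mem_erase hs)).2]⟩, ?_⟩
        have : (X - C r) * P₁ * ∏ s ∈ S.erase r, (X - C s) = P₁ * ∏ s ∈ S, (X - C s) := by
          rw [← Finset.mul_prod_erase S _ hrS]; ring
        rwa [this]
      · refine ⟨insert r S, ?_, ?_⟩
        · intro s hs
          rcases Finset.mem_insert.mp hs with rfl | hs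
          · exact ⟨hrab, hr0⟩
          · exact ⟨(hS s hs).1, by simp [(hS s hs).2]⟩
        · have : (X - C r) * P₁ * ∏ s ∈ insert r S, (X - C s)
              = (X - C r) ^ 2 * (P₁ * ∏ s ∈ S, (X - C s)) := by
            rw [Finset.prod_insert hrS]; ring
          rw [this]
          refine hsign.imp (fun h x hx => ?_) (fun h x hx => ?_)
          · rw [eval_mul]
            exact mul_nonneg (by rw [eval_pow]; positivity) (h x hx)
          · rw [eval_mul]
            exact mul_nonpos_of_nonneg_of_nonpos (by rw [eval_pow]; positivity) (h x hx)
    · push Not at hr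
      refine ⟨∅, by simp, ?_⟩
      simp only [Finset.prod_empty, mul_one]
      by_contra! hcon
      obtain ⟨⟨x, hx, hx0⟩, y, hy, hy0⟩ := hcon
      have := (isPreconnected_Ioo (a := a) (b := b)).intermediate_value hx hy
        P.continuous.continuousOn
      obtain ⟨z, hz, hz0⟩ := this ⟨hx0.le, hy0.le⟩
      exact hr z hz hz0

open Polynomial in
/-- `cos ((k + 1/2) t)` is `cos (t/2)` times a polynomial in `cos t`. -/
theorem exists_polynomial_cos_half (k : ℕ) :
    ∃ P : ℝ[X], ∀ t : ℝ, Real.cos ((k + 1 / 2) * t) = Real.cos (t / 2) * P.eval (Real.cos t) := by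
  induction k using Nat.twoStepInduction with
  | zero => exact ⟨1, fun t => by simp; ring_nf⟩
  | one =>
    refine ⟨2 * X - 1, fun t => ?_⟩
    have h : ((1 : ℕ) + 1 / 2 : ℝ) * t = 3 * (t / 2) := by push_cast; ring
    have h2 : Real.cos t = 2 * Real.cos (t / 2) ^ 2 - 1 := by
      rw [← Real.cos_two_mul]; ring_nf
    rw [h, Real.cos_three_mul]
    simp [h2]
    ring
  | more k ih₀ ih₁ =>
    obtain ⟨P₀, h₀⟩ := ih₀
    obtain ⟨P₁, h₁⟩ := ih₁
    refine ⟨2 * X * P₁ - P₀, fun t => ?_⟩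
    have h : Real.cos (((k + 2 : ℕ) + 1 / 2) * t)
        = 2 * Real.cos t * Real.cos (((k + 1 : ℕ) + 1 / 2) * t) - Real.cos ((k + 1 / 2) * t) := by
      have e₁ : ((k + 2 : ℕ) + 1 / 2 : ℝ) * t = ((k + 1 : ℕ) + 1 / 2) * t + t := by
        push_cast; ring
      have e₂ : (k + 1 / 2 : ℝ) * t = ((k + 1 : ℕ) + 1 / 2) * t - t := by
        push_cast; ring
      rw [e₁, e₂, Real.cos_add, Real.cos_sub]
      ring
    rw [h, h₀, h₁]
    simp
    ring

/-- Low powers of `cos t` times `cos (t/2)` are orthogonal to `cos ((k + 1/2) t)` on `[0, π]`. -/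
theorem integral_cos_half_mul_cos_pow (d : ℕ) : ∀ k : ℕ, d < k →
    ∫ t in (0 : ℝ)..Real.pi,
      Real.cos ((k + 1 / 2) * t) * Real.cos (t / 2) * Real.cos t ^ d = 0 := by
  induction d with
  | zero =>
    intro k hk
    have h : ∀ t : ℝ, Real.cos ((k + 1 / 2) * t) * Real.cos (t / 2) * Real.cos t ^ 0
        = (1 / 2) * (Real.cos ((k + 1 : ℕ) * t) + Real.cos (k * t)) := by
      intro t
      have e₁ : ((k + 1 : ℕ) : ℝ) * t = (k + 1 / 2) * t + t / 2 := by push_cast; ring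
      have e₂ : (k : ℝ) * t = (k + 1 / 2) * t - t / 2 := by ring
      rw [e₁, e₂, Real.cos_add, Real.cos_sub]
      ring
    have h0 : ∀ j : ℕ, 0 < j → ∫ t in (0 : ℝ)..Real.pi, Real.cos (j * t) = 0 := by
      intro j hj
      have : (j : ℝ) ≠ 0 := by positivity
      rw [intervalIntegral.integral_comp_mul_left (fun x => Real.cos x) this]
      simp [Real.sin_nat_mul_pi]
    simp_rw [h]
    rw [intervalIntegral.integral_const_mul, intervalIntegral.integral_add, h0 _ (by omega),
      h0 _ hk]
    · simp
    all_goals exact (by fun_prop : Continuous _).intervalIntegrable _ _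
  | succ d ih =>
    intro k hk
    obtain ⟨k, rfl⟩ : ∃ j, k = j + 1 := ⟨k - 1, by omega⟩
    -- Multiplication by `cos t` averages the two neighbouring frequencies; the lower one still
    -- exceeds the remaining power.
    have h : ∀ t : ℝ, Real.cos (((k + 1 : ℕ) + 1 / 2) * t) * Real.cos (t / 2) * Real.cos t ^ (d + 1)
        = (1 / 2) * (Real.cos (((k + 2 : ℕ) + 1 / 2) * t) * Real.cos (t / 2) * Real.cos t ^ d
          + Real.cos ((k + 1 / 2) * t) * Real.cos (t / 2) * Real.cos t ^ d) := by
      intro t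
      have e₁ : ((k + 2 : ℕ) + 1 / 2 : ℝ) * t = ((k + 1 : ℕ) + 1 / 2) * t + t := by
        push_cast; ring
      have e₂ : (k + 1 / 2 : ℝ) * t = ((k + 1 : ℕ) + 1 / 2) * t - t := by
        push_cast; ring
      rw [e₁, e₂, Real.cos_add, Real.cos_sub]
      ring
    simp_rw [h]
    rw [intervalIntegral.integral_const_mul, intervalIntegral.integral_add, ih _ (by omega),
      ih _ (by omega)]
    · simp
    all_goals exact (by fun_prop : Continuous _).intervalIntegrable _ _

open Polynomial in
theorem integral_cos_half_mul_eval_cos (k : ℕ) (Q : ℝ[X]) (hQ : Q.natDegree < k) :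
    ∫ t in (0 : ℝ)..Real.pi,
      Real.cos ((k + 1 / 2) * t) * (Real.cos (t / 2) * Q.eval (Real.cos t)) = 0 := by
  have h : ∀ t : ℝ, Real.cos ((k + 1 / 2) * t) * (Real.cos (t / 2) * Q.eval (Real.cos t))
      = ∑ d ∈ Finset.range (Q.natDegree + 1), Q.coeff d *
        (Real.cos ((k + 1 / 2) * t) * Real.cos (t / 2) * Real.cos t ^ d) := by
    intro t
    rw [Polynomial.eval_eq_sum_range, Finset.mul_sum, Finset.mul_sum]
    exact Finset.sum_congr rfl fun d _ => by ring
  simp_rw [h]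
  rw [intervalIntegral.integral_finsetSum]
  · refine Finset.sum_eq_zero fun d hd => ?_
    rw [intervalIntegral.integral_const_mul, integral_cos_half_mul_cos_pow, mul_zero]
    have := Finset.mem_range.mp hd
    omega
  · exact fun d _ => (by fun_prop : Continuous _).intervalIntegrable _ _

open Polynomial in
/-- A Sturm–Hurwitz type theorem: a positive combination of `cos ((l + 1/2) t)` with all `l ≥ m`
has at least `m` zeros in `(0, π)`. -/
theorem exists_zeros_sum_cos_half {ι : Type*} [Fintype ι] [Nonempty ι] (w : ι → ℝ)
    (hw : ∀ i, 0 < w i) (l : ι → ℕ) (m : ℕ) (hl : ∀ i, m ≤ l i) :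
    ∃ t : Fin m → ℝ, Function.Injective t ∧ ∀ j, 0 < t j ∧ t j < Real.pi ∧
      ∑ i, w i * Real.cos ((l i + 1 / 2) * t j) = 0 := by
  choose p hp using exists_polynomial_cos_half
  set P : ℝ[X] := ∑ i, C (w i) * p (l i) with hPdef
  have hf : ∀ t, ∑ i, w i * Real.cos ((l i + 1 / 2) * t)
      = Real.cos (t / 2) * P.eval (Real.cos t) := by
    intro t
    rw [hPdef, Polynomial.eval_finsetSum, Finset.mul_sum]
    refine Finset.sum_congr rfl fun i _ => ?_
    rw [hp]; simp; ring
  have hP1 : 0 < P.eval 1 := by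
    have := hf 0
    simp only [mul_zero, Real.cos_zero, mul_one, zero_div, one_mul] at this
    rw [← this]
    exact Finset.sum_pos (fun i _ => hw i) Finset.univ_nonempty
  have hP0 : P ≠ 0 := by rintro h; simp [h] at hP1
  obtain ⟨S, hS, hsign⟩ := exists_roots_mul_prod_constant_sign (-1) 1 _ P hP0 rfl
  -- With fewer than `m` sign changes, `Q` below has degree less than `m`, while `P * Q` has
  -- constant sign: the integral against `Q` would be both positive and zero.
  have hcard : m ≤ S.card := by
    by_contra! hlt
    set Q : ℝ[X] := ∏ s ∈ S, (X - C s) with hQ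
    have hdeg : Q.natDegree < m := by rwa [hQ, natDegree_finsetProd_X_sub_C_eq_card]
    have hQ1 : 0 < Q.eval 1 := by
      rw [hQ, eval_prod]
      refine Finset.prod_pos fun s hs => ?_
      have := (hS s hs).1.2
      simpa using this
    have hmem : ∀ t ∈ Set.Ioc 0 Real.pi, t ≠ Real.pi → Real.cos t ∈ Set.Ioo (-1 : ℝ) 1 := by
      intro t ht hne
      have hlt : t < Real.pi := lt_of_le_of_ne ht.2 hne
      constructor
      · rw [← Real.cos_pi]
        exact Real.cos_lt_cos_of_nonneg_of_le_pi ht.1.le le_rfl hlt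
      · rw [← Real.cos_zero]
        exact Real.cos_lt_cos_of_nonneg_of_le_pi le_rfl hlt.le ht.1
    -- The value at the endpoint `1`, positive for both `P` and `Q`, decides the sign.
    have hnn : ∀ x ∈ Set.Ioo (-1 : ℝ) 1, 0 ≤ (P * Q).eval x := by
      rcases hsign with h | h
      · exact h
      · exfalso
        have h1 : (1 : ℝ) ∈ closure (Set.Ioo (-1 : ℝ) 1) := by
          rw [closure_Ioo (by norm_num)]; simp
        have hcl : closure (Set.Ioo (-1 : ℝ) 1) ⊆ {x | (P * Q).eval x ≤ 0} :=
          closure_minimal h (isClosed_le (P * Q).continuous continuous_const)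
        have := hcl h1
        simp only [Set.mem_ofPred_eq, eval_mul] at this
        exact absurd (mul_pos hP1 hQ1) (not_lt.mpr this)
    have hpos : 0 < ∫ t in (0 : ℝ)..Real.pi, (∑ i, w i * Real.cos ((l i + 1 / 2) * t)) *
        (Real.cos (t / 2) * Q.eval (Real.cos t)) := by
      have he : ∀ t, (∑ i, w i * Real.cos ((l i + 1 / 2) * t)) *
          (Real.cos (t / 2) * Q.eval (Real.cos t))
          = Real.cos (t / 2) ^ 2 * (P * Q).eval (Real.cos t) := by
        intro t; rw [hf, eval_mul]; ring
      simp_rw [he]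
      refine intervalIntegral.integral_pos Real.pi_pos ?_ ?_ ⟨0, ⟨le_rfl, Real.pi_pos.le⟩, ?_⟩
      · exact Continuous.continuousOn (by fun_prop)
      · intro t ht
        -- At `π` the point `cos t = -1` leaves the open interval, but the factor `cos (t/2)`
        -- vanishes.
        by_cases hne : t = Real.pi
        · simp [hne]
        · exact mul_nonneg (sq_nonneg _) (hnn _ (hmem t ht hne))
      · simpa using mul_pos hP1 hQ1
    have hzero : ∫ t in (0 : ℝ)..Real.pi, (∑ i, w i * Real.cos ((l i + 1 / 2) * t)) *
        (Real.cos (t / 2) * Q.eval (Real.cos t)) = 0 := by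
      simp_rw [Finset.sum_mul, mul_assoc]
      rw [intervalIntegral.integral_finsetSum]
      · refine Finset.sum_eq_zero fun i _ => ?_
        rw [intervalIntegral.integral_const_mul,
          integral_cos_half_mul_eval_cos _ _ (hdeg.trans_le (hl i)), mul_zero]
      · exact fun i _ => (by fun_prop : Continuous _).intervalIntegrable _ _
    exact hpos.ne' hzero
  obtain ⟨T, hTS, hT⟩ := Finset.exists_subset_card_eq hcard
  let e := T.equivFinOfCardEq hT
  have hs : ∀ j, ((e.symm j : T) : ℝ) ∈ Set.Ioo (-1 : ℝ) 1 ∧ P.eval ((e.symm j : T) : ℝ) = 0 :=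
    fun j => hS _ (hTS (e.symm j).2)
  refine ⟨fun j => Real.arccos (e.symm j : T), ?_, fun j => ⟨?_, ?_, ?_⟩⟩
  · intro i j hij
    have := Real.arccos_injOn ⟨(hs i).1.1.le, (hs i).1.2.le⟩ ⟨(hs j).1.1.le, (hs j).1.2.le⟩ hij
    exact e.symm.injective (Subtype.ext this)
  · exact Real.arccos_pos.mpr (hs j).1.2
  · rw [← Real.arccos_neg_one]
    exact Real.arccos_lt_arccos le_rfl (hs j).1.1 (hs j).1.2.le
  · rw [hf, Real.cos_arccos (hs j).1.1.le (hs j).1.2.le, (hs j).2, mul_zero]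

/-! ### Moments at `e₀` determine a Jacobi matrix -/

theorem IsJacobi.pow_apply_zero_eq_zero {N : ℕ} {J : Matrix (Fin (N + 1)) (Fin (N + 1)) ℝ}
    (hJ : IsJacobi J) (d : ℕ) : ∀ i : Fin (N + 1), d < (i : ℕ) → (J ^ d) i 0 = 0 := by
  induction d with
  | zero =>
    intro i hi
    have : i ≠ 0 := by rintro rfl; simp at hi
    simp [this]
  | succ d ih =>
    intro i hi
    rw [pow_succ', Matrix.mul_apply]
    refine Finset.sum_eq_zero fun k _ => ?_
    by_cases hk : d < (k : ℕ)
    · rw [ih k hk, mul_zero]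
    · rw [← hJ.symm.apply i k, hJ.tridiagonal k i (by omega), zero_mul]

/-- Only one path of length `d` leads from `0` to `d`, so the entry is `b_0 ⋯ b_{d-1}`. -/
theorem IsJacobi.pow_apply_zero_pos {N : ℕ} {J : Matrix (Fin (N + 1)) (Fin (N + 1)) ℝ}
    (hJ : IsJacobi J) (d : ℕ) : ∀ i : Fin (N + 1), (i : ℕ) = d → 0 < (J ^ d) i 0 := by
  induction d with
  | zero =>
    intro i hi
    have : i = 0 := Fin.ext hi
    simp [this]
  | succ d ih =>
    intro i hi
    have hlt : d < N := by omega
    obtain rfl : i = (⟨d, hlt⟩ : Fin N).succ := Fin.ext hi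
    rw [pow_succ', Matrix.mul_apply, Finset.sum_eq_single (⟨d, hlt⟩ : Fin N).castSucc]
    · refine mul_pos ?_ (ih _ rfl)
      rw [← hJ.symm.apply]
      exact hJ.offDiag_pos _
    · intro k _ hk
      rcases lt_or_gt_of_ne (fun h => hk (Fin.ext h) :
        (k : ℕ) ≠ ((⟨d, hlt⟩ : Fin N).castSucc : ℕ)) with h | h
      · rw [← hJ.symm.apply, hJ.tridiagonal k _ (by simpa using h), zero_mul]
      · rw [hJ.pow_apply_zero_eq_zero d k (by simpa using h), mul_zero]
    · simp

/-- Uniqueness of the Cholesky factor. -/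
theorem eq_of_transpose_mul_self_eq {n : ℕ} {K K' : Matrix (Fin n) (Fin n) ℝ}
    (hK : K.BlockTriangular id) (hK' : K'.BlockTriangular id)
    (hpos : ∀ i, 0 < K i i) (hpos' : ∀ i, 0 < K' i i) (h : Kᵀ * K = K'ᵀ * K') : K = K' := by
  have split : ∀ A : Matrix (Fin n) (Fin n) ℝ, A.BlockTriangular id → ∀ i j,
      (Aᵀ * A) i j = ∑ r ∈ Finset.Iio i, A r i * A r j + A i i * A i j := by
    intro A hA i j
    rw [Matrix.mul_apply, ← Finset.sum_subset (Finset.subset_univ (Finset.Iic i)),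
      ← Finset.Iio_insert, Finset.sum_insert (by simp), add_comm]
    · rfl
    · intro r _ hr
      have : i < r := by simpa using hr
      rw [Matrix.transpose_apply, hA this, zero_mul]
  have rows : ∀ i, ∀ j, K i j = K' i j := by
    intro i
    induction i using WellFoundedLT.induction with
    | _ i ih =>
    -- Once the rows above `i` agree, their contributions cancel; the case `j = i` and positivity
    -- then fix the diagonal entry.
    have key : ∀ j, K i i * K i j = K' i i * K' i j := by
      intro j
      have := congrFun (congrFun h i) j
      rw [split K hK, split K' hK', Finset.sum_congr rfl (fun r hr => by
        rw [ih r (Finset.mem_Iio.mp hr), ih r (Finset.mem_Iio.mp hr)])] at this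
      exact add_left_cancel this
    have hd : K i i = K' i i := by
      have := key i
      rwa [mul_self_inj (hpos i).le (hpos' i).le] at this
    intro j
    have := key j
    rw [← hd] at this
    exact mul_left_cancel₀ (hpos i).ne' this
  exact Matrix.ext rows

/-- A Jacobi matrix is determined by the moments of its spectral measure at `e₀`. -/
theorem IsJacobi.eq_of_moments {N : ℕ} {J J' : Matrix (Fin (N + 1)) (Fin (N + 1)) ℝ}
    (hJ : IsJacobi J) (hJ' : IsJacobi J') (h : ∀ d, (J ^ d) 0 0 = (J' ^ d) 0 0) : J = J' := by
  -- The Krylov matrix, with columns `A ^ d e₀`: triangular with positive diagonal. Both `Kᵀ K` and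
  -- `Kᵀ A K` are Hankel matrices of moments, so the first recovers `K` and the second recovers `A`.
  let K : Matrix (Fin (N + 1)) (Fin (N + 1)) ℝ → Matrix (Fin (N + 1)) (Fin (N + 1)) ℝ :=
    fun A => Matrix.of fun i d => (A ^ (d : ℕ)) i 0
  have tri : ∀ A, IsJacobi A → (K A).BlockTriangular id :=
    fun A hA i d hid => hA.pow_apply_zero_eq_zero d i hid
  have pos : ∀ A, IsJacobi A → ∀ i, 0 < K A i i := fun A hA i => hA.pow_apply_zero_pos i i rfl
  have mom : ∀ A, IsJacobi A → ∀ d e, ((K A)ᵀ * K A) d e = (A ^ ((d : ℕ) + e)) 0 0 := by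
    intro A hA d e
    rw [pow_add, Matrix.mul_apply, Matrix.mul_apply]
    refine Finset.sum_congr rfl fun i _ => ?_
    rw [← (hA.symm.pow (d : ℕ)).apply 0 i]
    rfl
  have mom' : ∀ A, IsJacobi A → ∀ d e,
      ((K A)ᵀ * (A * K A)) d e = (A ^ ((d : ℕ) + (e + 1))) 0 0 := by
    intro A hA d e
    rw [pow_add, Matrix.mul_apply, Matrix.mul_apply]
    refine Finset.sum_congr rfl fun i _ => ?_
    rw [← (hA.symm.pow (d : ℕ)).apply 0 i, pow_succ', Matrix.mul_apply, Matrix.mul_apply]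
    rfl
  have hKK : K J = K J' := by
    refine eq_of_transpose_mul_self_eq (tri J hJ) (tri J' hJ') (pos J hJ) (pos J' hJ') ?_
    ext d e
    rw [mom J hJ, mom J' hJ', h]
  have hdet : IsUnit (K J) := by
    rw [Matrix.isUnit_iff_isUnit_det, Matrix.det_of_isUpperTriangular (tri J hJ), isUnit_iff_ne_zero]
    exact Finset.prod_ne_zero_iff.mpr fun i _ => (pos J hJ i).ne'
  have hJK : (K J)ᵀ * (J * K J) = (K J)ᵀ * (J' * K J) := by
    ext d e
    conv_rhs => rw [hKK]
    rw [mom' J hJ, mom' J' hJ', h]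
  have hT : IsUnit (K J)ᵀ := (Matrix.isUnit_transpose (K J)).mpr hdet
  exact hdet.mul_right_cancel (hT.mul_left_cancel hJK)

/-! ### Spectral decompositions and eigenvector components -/

/-- `J = Qᵀ Λ Q` with `Q` orthogonal and `Λ` diagonal; the rows of `Q` are eigenvectors of `J`. -/
structure IsSpectralDecomposition {N : ℕ} (J : Matrix (Fin (N + 1)) (Fin (N + 1)) ℝ)
    (lam : Fin (N + 1) → ℝ) (Q : Matrix (Fin (N + 1)) (Fin (N + 1)) ℝ) : Prop where
  orthogonal : Qᵀ * Q = 1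
  eq_conj : J = Qᵀ * diagonal lam * Q

namespace IsSpectralDecomposition

variable {N : ℕ} {J Q : Matrix (Fin (N + 1)) (Fin (N + 1)) ℝ} {lam : Fin (N + 1) → ℝ}

theorem orthogonal' (h : IsSpectralDecomposition J lam Q) : Q * Qᵀ = 1 :=
  mul_eq_one_comm.mp h.orthogonal

theorem sum_sq (h : IsSpectralDecomposition J lam Q) (i : Fin (N + 1)) : ∑ k, Q k i ^ 2 = 1 := by
  have := congrFun (congrFun h.orthogonal i) i
  simpa [Matrix.mul_apply, sq] using this

theorem pow_eq (h : IsSpectralDecomposition J lam Q) (d : ℕ) :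
    J ^ d = Qᵀ * diagonal (lam ^ d) * Q := by
  induction d with
  | zero => simp [h.orthogonal]
  | succ d ih =>
    rw [pow_succ, ih]
    nth_rw 1 [h.eq_conj]
    calc Qᵀ * diagonal (lam ^ d) * Q * (Qᵀ * diagonal lam * Q)
        = Qᵀ * diagonal (lam ^ d) * (Q * Qᵀ) * diagonal lam * Q := by simp only [Matrix.mul_assoc]
      _ = _ := by
        rw [h.orthogonal', Matrix.mul_one, Matrix.mul_assoc Qᵀ, Matrix.diagonal_mul_diagonal,
          pow_succ]
        rfl

theorem pow_apply (h : IsSpectralDecomposition J lam Q) (d : ℕ) (i j : Fin (N + 1)) :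
    (J ^ d) i j = ∑ k, Q k i * Q k j * lam k ^ d := by
  rw [h.pow_eq, Matrix.mul_apply]
  refine Finset.sum_congr rfl fun k _ => ?_
  rw [Matrix.mul_diagonal]
  simp only [Matrix.transpose_apply, Pi.pow_apply]
  ring

theorem sum_coeff_mul_pow_apply (h : IsSpectralDecomposition J lam Q) (p : Polynomial ℝ)
    (i j : Fin (N + 1)) :
    ∑ d ∈ Finset.range (p.natDegree + 1), p.coeff d * (J ^ d) i j
      = ∑ k, Q k i * Q k j * p.eval (lam k) := by
  simp_rw [h.pow_apply, Polynomial.eval_eq_sum_range, Finset.mul_sum]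
  rw [Finset.sum_comm]
  exact Finset.sum_congr rfl fun k _ => Finset.sum_congr rfl fun d _ => by ring

/-- Evaluation at the Lagrange type polynomial `∏_{j ≠ k} (X - λ_j)`. -/
theorem sum_coeff_mul_pow_apply_prod (h : IsSpectralDecomposition J lam Q) (i j k : Fin (N + 1)) :
    ∑ d ∈ Finset.range (N + 1),
      (∏ l ∈ Finset.univ.erase k, (Polynomial.X - Polynomial.C (lam l))).coeff d * (J ^ d) i j
      = Q k i * Q k j * ∏ l ∈ Finset.univ.erase k, (lam k - lam l) := by
  have hdeg : (∏ l ∈ Finset.univ.erase k,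
      (Polynomial.X - Polynomial.C (lam l))).natDegree = N := by
    rw [Polynomial.natDegree_finsetProd_X_sub_C_eq_card]; simp
  have := h.sum_coeff_mul_pow_apply
    (∏ l ∈ Finset.univ.erase k, (Polynomial.X - Polynomial.C (lam l))) i j
  rw [hdeg] at this
  rw [this, Finset.sum_eq_single k]
  · simp [Polynomial.eval_prod]
  · intro l _ hl
    have : (∏ l ∈ Finset.univ.erase k,
        (Polynomial.X - Polynomial.C (lam l))).eval (lam l) = 0 := by
      rw [Polynomial.eval_prod]
      exact Finset.prod_eq_zero (Finset.mem_erase.mpr ⟨hl, Finset.mem_univ _⟩) (by simp)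
    rw [this, mul_zero]
  · simp

/-- The product of the extreme components of an eigenvector of a Jacobi matrix. -/
theorem mul_last_mul_prod (h : IsSpectralDecomposition J lam Q) (hJ : IsJacobi J)
    (k : Fin (N + 1)) :
    Q k (Fin.last N) * Q k 0 * ∏ l ∈ Finset.univ.erase k, (lam k - lam l)
      = (J ^ N) (Fin.last N) 0 := by
  -- Powers below `N` do not reach the corner entry, and the polynomial is monic of degree `N`.
  rw [← h.sum_coeff_mul_pow_apply_prod, Finset.sum_range_succ, Finset.sum_eq_zero, zero_add]
  · have hdeg : (∏ l ∈ Finset.univ.erase k,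
        (Polynomial.X - Polynomial.C (lam l))).natDegree = N := by
      rw [Polynomial.natDegree_finsetProd_X_sub_C_eq_card]; simp
    have hmon := Polynomial.monic_prod_X_sub_C lam (Finset.univ.erase k)
    rw [Polynomial.Monic, Polynomial.leadingCoeff, hdeg] at hmon
    rw [hmon, one_mul]
  · intro d hd
    rw [hJ.pow_apply_zero_eq_zero d _ (by simpa using hd), mul_zero]

/-- Moments recover each weight: test them on the polynomial vanishing at all the other eigenvalues.
-/
theorem sq_eq_of_moments (h : IsSpectralDecomposition J lam Q) (hlam : Function.Injective lam)
    {i j : Fin (N + 1)} (hm : ∀ d, (J ^ d) i i = (J ^ d) j j) (k : Fin (N + 1)) :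
    Q k i ^ 2 = Q k j ^ 2 := by
  have hi := h.sum_coeff_mul_pow_apply_prod i i k
  simp_rw [hm, h.sum_coeff_mul_pow_apply_prod j j k] at hi
  have hne : ∏ l ∈ Finset.univ.erase k, (lam k - lam l) ≠ 0 :=
    Finset.prod_ne_zero_iff.mpr fun l hl =>
      sub_ne_zero.mpr fun e => (Finset.ne_of_mem_erase hl) (hlam e).symm
  rw [sq, sq]
  exact (mul_right_cancel₀ hne hi).symm

theorem spectrum_eq (h : IsSpectralDecomposition J lam Q) : spectrum ℝ J = Set.range lam := by
  let u : (Matrix (Fin (N + 1)) (Fin (N + 1)) ℝ)ˣ := ⟨Qᵀ, Q, h.orthogonal, h.orthogonal'⟩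
  have : J = (u : Matrix _ _ ℝ) * diagonal lam * ((u⁻¹ : _) : Matrix _ _ ℝ) := h.eq_conj
  rw [this, spectrum.units_conjugate, spectrum_diagonal]

theorem submatrix_rev (h : IsSpectralDecomposition J lam Q) :
    IsSpectralDecomposition (J.submatrix Fin.rev Fin.rev) lam (Q.submatrix id Fin.rev) where
  orthogonal := by
    have := congrArg (fun A => A.submatrix Fin.rev Fin.rev) h.orthogonal
    rw [Matrix.submatrix_one _ Fin.rev_injective] at this
    rw [← this]; rfl
  eq_conj := by
    nth_rw 1 [h.eq_conj]
    rfl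

theorem evolvedState_apply (h : IsSpectralDecomposition J lam Q) (t : ℝ) (i : Fin (N + 1)) :
    evolvedState J t i
      = ∑ k, (Q k i : ℂ) * Q k 0 * Complex.exp (-(Complex.I * t) * lam k) := by
  have hu : (Q.map Complex.ofReal)ᵀ * Q.map Complex.ofReal = 1 := by
    have := congrArg (fun A => A.map Complex.ofRealHom) h.orthogonal
    simp only [Matrix.map_mul, Matrix.map_one _ (map_zero _) (map_one _)] at this
    exact this
  let u : (Matrix (Fin (N + 1)) (Fin (N + 1)) ℂ)ˣ :=
    ⟨(Q.map Complex.ofReal)ᵀ, Q.map Complex.ofReal, hu, mul_eq_one_comm.mp hu⟩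
  have hJ : (-(Complex.I * (t : ℂ))) • J.map Complex.ofReal
      = (u : Matrix _ _ ℂ) * diagonal (fun k => -(Complex.I * (t : ℂ)) * lam k)
        * ((u⁻¹ : _) : Matrix _ _ ℂ) := by
    have h1 : J.map Complex.ofReal
        = (Q.map Complex.ofReal)ᵀ * diagonal (fun k => (lam k : ℂ)) * Q.map Complex.ofReal := by
      have := congrArg (fun A => A.map Complex.ofRealHom) h.eq_conj
      simp only [Matrix.map_mul, Matrix.diagonal_map (map_zero Complex.ofRealHom)] at this
      exact this
    have h2 : diagonal (fun k => -(Complex.I * (t : ℂ)) * lam k)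
        = (-(Complex.I * (t : ℂ))) • diagonal (fun k => (lam k : ℂ)) := by
      rw [← Matrix.diagonal_smul]; rfl
    rw [h1, h2, Matrix.mul_smul, Matrix.smul_mul]
    rfl
  rw [evolvedState, hJ, Matrix.exp_units_conj, Matrix.exp_diagonal, Matrix.mulVec_single_one]
  simp only [Matrix.col_apply]
  rw [Matrix.mul_apply]
  refine Finset.sum_congr rfl fun k _ => ?_
  rw [Matrix.mul_diagonal]
  have : NormedSpace.exp (fun k => -(Complex.I * (t : ℂ)) * (lam k : ℂ)) k
      = Complex.exp (-(Complex.I * t) * lam k) := by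
    rw [Pi.coe_exp, Complex.exp_eq_exp_ℂ]
  rw [this]
  change (Q k i : ℂ) * _ * (Q k 0 : ℂ) = _
  ring

end IsSpectralDecomposition

/-- A symmetric matrix with `N + 1` distinct eigenvalues is diagonalized in the given order. -/
theorem exists_isSpectralDecomposition {N : ℕ} {J : Matrix (Fin (N + 1)) (Fin (N + 1)) ℝ}
    (hJ : J.IsSymm) {lam : Fin (N + 1) → ℝ} (hlam : Function.Injective lam)
    (hs : spectrum ℝ J = Set.range lam) : ∃ Q, IsSpectralDecomposition J lam Q := by
  have hH : J.IsHermitian := by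
    rw [Matrix.IsHermitian, Matrix.conjTranspose_eq_transpose_of_trivial]; exact hJ
  have hr : Set.range lam = Set.range hH.eigenvalues := by
    rw [← hs, hH.spectrum_real_eq_range_eigenvalues]
  -- `hH.eigenvalues` has its own order; injectivity of `lam` makes the matching `σ` a permutation.
  choose σ hσ using fun k => (hr ▸ Set.mem_range_self k : lam k ∈ Set.range hH.eigenvalues)
  have hinj : Function.Injective σ := fun i j hij => hlam (by rw [← hσ, ← hσ, hij])
  let e : Fin (N + 1) ≃ Fin (N + 1) := Equiv.ofBijective σ (Finite.injective_iff_bijective.mp hinj)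
  set U : Matrix (Fin (N + 1)) (Fin (N + 1)) ℝ := hH.eigenvectorUnitary.1
  have hUU : U * Uᵀ = 1 := by
    have := Unitary.mul_star_self_of_mem hH.eigenvectorUnitary.2
    rwa [Matrix.star_eq_conjTranspose, Matrix.conjTranspose_eq_transpose_of_trivial] at this
  have hJU : J = U * diagonal hH.eigenvalues * Uᵀ := by
    have := hH.spectral_theorem
    rw [Unitary.conjStarAlgAut_apply, Matrix.star_eq_conjTranspose,
      Matrix.conjTranspose_eq_transpose_of_trivial] at this
    exact this
  have hl : lam = hH.eigenvalues ∘ e := funext fun k => (hσ k).symm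
  refine ⟨Uᵀ.submatrix e id, ?_, ?_⟩
  · rw [Matrix.transpose_submatrix, Matrix.transpose_transpose, Matrix.submatrix_mul_equiv, hUU,
      Matrix.submatrix_id_id]
  · rw [hl, ← Matrix.submatrix_diagonal_equiv, Matrix.transpose_submatrix,
      Matrix.transpose_transpose, Matrix.submatrix_mul_equiv, Matrix.submatrix_mul_equiv, ← hJU,
      Matrix.submatrix_id_id]

/-! ### Inverse problem by Gram–Schmidt -/

/-- Existence of a Jacobi matrix with given simple spectrum and spectral weights. -/
theorem exists_isJacobi_of_weights {N : ℕ} (lam : Fin (N + 1) → ℝ)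
    (hlam : Function.Injective lam) (w : Fin (N + 1) → ℝ) (hw : ∀ k, 0 < w k)
    (hsum : ∑ k, w k = 1) :
    ∃ J Q, IsJacobi J ∧ IsSpectralDecomposition J lam Q ∧ ∀ k, Q k 0 ^ 2 = w k := by
  -- Krylov vectors `Λ ^ j √w`, independent by Vandermonde. In their Gram–Schmidt basis `Λ` becomes
  -- a Jacobi matrix.
  let v : Fin (N + 1) → EuclideanSpace ℝ (Fin (N + 1)) :=
    fun j => WithLp.toLp 2 fun k => √(w k) * lam k ^ (j : ℕ)
  have hv : ∀ j k, v j k = √(w k) * lam k ^ (j : ℕ) := fun _ _ => rfl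
  have hli : LinearIndependent ℝ v := by
    rw [Fintype.linearIndependent_iff]
    intro g hg
    have : (vandermonde lam) *ᵥ g = 0 := by
      ext k
      have hk := congrArg (fun x : EuclideanSpace ℝ (Fin (N + 1)) => x k) hg
      simp only [WithLp.ofLp_sum, WithLp.ofLp_smul, Finset.sum_apply, Pi.smul_apply, hv,
        smul_eq_mul, PiLp.zero_apply] at hk
      have hk' : √(w k) * ∑ j : Fin (N + 1), lam k ^ (j : ℕ) * g j = 0 := by
        rw [Finset.mul_sum, ← hk]
        exact Finset.sum_congr rfl fun j _ => by ring
      exact (mul_eq_zero.mp hk').resolve_left (Real.sqrt_pos.mpr (hw k)).ne'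
    have := eq_zero_of_mulVec_eq_zero (det_vandermonde_ne_zero_iff.mpr hlam) this
    exact fun i => congrFun this i
  let Λ : EuclideanSpace ℝ (Fin (N + 1)) →ₗ[ℝ] EuclideanSpace ℝ (Fin (N + 1)) :=
    Matrix.toEuclideanLin (diagonal lam)
  have hΛ : ∀ x k, Λ x k = lam k * x k := fun x k => by
    simp [Λ, Matrix.toLpLin_apply, Matrix.mulVec_diagonal]
  have hΛv : ∀ j : Fin N, Λ (v j.castSucc) = v j.succ := by
    intro j
    ext k
    rw [hΛ, hv, hv, Fin.val_castSucc, Fin.val_succ]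
    ring
  let g := InnerProductSpace.gramSchmidt ℝ v
  let q := InnerProductSpace.gramSchmidtNormed ℝ v
  have hon : Orthonormal ℝ q := InnerProductSpace.gramSchmidtNormed_orthonormal hli
  have hgpos : ∀ i, 0 < ‖g i‖ := fun i =>
    norm_pos_iff.mpr (InnerProductSpace.gramSchmidt_ne_zero i hli)
  have hq : ∀ i, q i = ‖g i‖⁻¹ • g i := fun i => rfl
  have hinner : ∀ x y : EuclideanSpace ℝ (Fin (N + 1)), inner ℝ x y = ∑ k, x k * y k := by
    intro x y
    rw [PiLp.inner_apply]
    exact Finset.sum_congr rfl fun k _ => by simp [mul_comm]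
  have hΛspan : ∀ (j : Fin (N + 1)) (s : ℕ), s ≤ (j : ℕ) →
      ∀ x ∈ Submodule.span ℝ (v '' {i | (i : ℕ) < s}),
        Λ x ∈ Submodule.span ℝ (v '' Set.Iic j) := by
    intro j s hs x hx
    have hle : Submodule.span ℝ (v '' {i | (i : ℕ) < s})
        ≤ (Submodule.span ℝ (v '' Set.Iic j)).comap Λ := by
      rw [Submodule.span_le]
      rintro _ ⟨i, hi, rfl⟩
      have hi' : (i : ℕ) < s := hi
      have hiN : (i : ℕ) < N := by omega
      have : Λ (v i) = v (⟨i, hiN⟩ : Fin N).succ := hΛv ⟨i, hiN⟩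
      rw [SetLike.mem_coe, Submodule.mem_comap, this]
      refine Submodule.subset_span ⟨_, ?_, rfl⟩
      rw [Set.mem_Iic, Fin.le_def, Fin.val_succ]
      change (i : ℕ) + 1 ≤ j
      omega
    exact hle hx
  have horth : ∀ (i : Fin (N + 1)) (x : EuclideanSpace ℝ (Fin (N + 1))),
      x ∈ Submodule.span ℝ (v '' Set.Iio i) → inner ℝ (g i) x = 0 := by
    intro i x hx
    induction hx using Submodule.span_induction with
    | mem y hy =>
      obtain ⟨j, hj, rfl⟩ := hy
      exact InnerProductSpace.gramSchmidt_inv_triangular ℝ v hj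
    | zero => simp
    | add y z _ _ hy hz => rw [inner_add_right, hy, hz, add_zero]
    | smul a y _ hy => rw [inner_smul_right, hy, mul_zero]
  have hgv : ∀ i, v i - g i ∈ Submodule.span ℝ (v '' Set.Iio i) := by
    intro i
    rw [← InnerProductSpace.span_gramSchmidt_Iio ℝ v i, InnerProductSpace.gramSchmidt_def' ℝ v i]
    simp only [g, add_sub_cancel_left]
    refine Submodule.sum_mem _ fun k hk => ?_
    rw [Submodule.starProjection_singleton]
    exact Submodule.smul_mem _ _ (Submodule.subset_span ⟨k, Finset.mem_Iio.mp hk, rfl⟩)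
  have htri : ∀ i j : Fin (N + 1), (j : ℕ) + 1 < (i : ℕ) → inner ℝ (g i) (Λ (g j)) = 0 := by
    intro i j hij
    apply horth
    have hj : g j ∈ Submodule.span ℝ (v '' {r | (r : ℕ) < (j : ℕ) + 1}) := by
      refine Submodule.span_mono (Set.image_mono ?_)
        (InnerProductSpace.gramSchmidt_mem_span ℝ v (le_refl j))
      intro r hr
      exact Nat.lt_succ_of_le hr
    refine Submodule.span_mono (Set.image_mono ?_) (hΛspan ⟨(j : ℕ) + 1, by omega⟩ _ le_rfl _ hj)
    intro r hr
    exact lt_of_le_of_lt hr hij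
  -- Modulo vectors orthogonal to `g_{j+1}`, `Λ g_j` equals `Λ v_j = v_{j+1}`, which in turn equals
  -- `g_{j+1}`.
  have hsub : ∀ j : Fin N, inner ℝ (g j.succ) (Λ (g j.castSucc)) = ‖g j.succ‖ ^ 2 := by
    intro j
    have h1 : inner ℝ (g j.succ) (Λ (v j.castSucc - g j.castSucc)) = 0 := by
      apply horth
      have h2 : v j.castSucc - g j.castSucc
          ∈ Submodule.span ℝ (v '' {r | (r : ℕ) < (j.castSucc : ℕ)}) := hgv j.castSucc
      refine Submodule.span_mono (Set.image_mono ?_) (hΛspan j.castSucc _ le_rfl _ h2)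
      intro r hr
      exact lt_of_le_of_lt hr j.castSucc_lt_succ
    have h3 := horth _ _ (hgv j.succ)
    rw [map_sub, hΛv, inner_sub_right, sub_eq_zero] at h1
    rw [inner_sub_right, sub_eq_zero, real_inner_self_eq_norm_sq] at h3
    rw [← h1, h3]
  let Q : Matrix (Fin (N + 1)) (Fin (N + 1)) ℝ := of fun k i => q i k
  have hJ : ∀ i j, (Qᵀ * diagonal lam * Q) i j = ‖g i‖⁻¹ * (‖g j‖⁻¹ * inner ℝ (g i) (Λ (g j))) := by
    intro i j
    rw [← real_inner_smul_right, ← map_smul, ← real_inner_smul_left, ← hq, ← hq, hinner,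
      Matrix.mul_apply]
    refine Finset.sum_congr rfl fun k _ => ?_
    rw [Matrix.mul_diagonal, hΛ]
    simp only [Matrix.transpose_apply, Q, of_apply]
    ring
  have hsymm : (Qᵀ * diagonal lam * Q).IsSymm := by
    rw [Matrix.IsSymm, Matrix.transpose_mul, Matrix.transpose_mul, Matrix.transpose_transpose,
      Matrix.diagonal_transpose, Matrix.mul_assoc]
  refine ⟨Qᵀ * diagonal lam * Q, Q, ⟨hsymm, ?_, ?_⟩, ⟨?_, rfl⟩, ?_⟩
  · intro i j hij
    rw [← hsymm.apply, hJ, htri j i hij, mul_zero, mul_zero]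
  · intro k
    rw [← hsymm.apply, hJ, hsub]
    have := hgpos k.succ
    have := hgpos k.castSucc
    positivity
  · ext i j
    rw [Matrix.mul_apply, Matrix.one_apply, ← (orthonormal_iff_ite.mp hon i j), hinner]
    rfl
  · intro k
    have hg0 : g 0 = v 0 := InnerProductSpace.gramSchmidt_bot ℝ v
    have hn : ‖g 0‖ = 1 := by
      rw [hg0, ← sq_eq_sq₀ (norm_nonneg _) zero_le_one, ← real_inner_self_eq_norm_sq, hinner,
        one_pow, ← hsum]
      refine Finset.sum_congr rfl fun k _ => ?_
      rw [hv]
      simp [Real.mul_self_sqrt (hw k).le]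
    change (q 0 k) ^ 2 = w k
    rw [hq, hn, hg0, inv_one, one_smul, hv]
    simp [Real.sq_sqrt (hw k).le]

/-! ### Persymmetry and the spectral weights -/

theorem IsJacobi.submatrix_rev {N : ℕ} {J : Matrix (Fin (N + 1)) (Fin (N + 1)) ℝ}
    (hJ : IsJacobi J) : IsJacobi (J.submatrix Fin.rev Fin.rev) where
  symm := hJ.symm.submatrix _
  tridiagonal i j hij := by
    rw [Matrix.submatrix_apply, ← hJ.symm.apply]
    exact hJ.tridiagonal _ _ (by rw [Fin.val_rev, Fin.val_rev]; omega)
  offDiag_pos k := by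
    rw [Matrix.submatrix_apply, ← hJ.symm.apply, Fin.rev_succ, Fin.rev_castSucc]
    exact hJ.offDiag_pos _

/-- Turns the entrywise condition into invariance under reversal of the basis; symmetry and
tridiagonality account for the entries the definition omits. -/
theorem IsJacobi.isPersymmetric_iff {N : ℕ} {J : Matrix (Fin (N + 1)) (Fin (N + 1)) ℝ}
    (hJ : IsJacobi J) : IsPersymmetric J ↔ J.submatrix Fin.rev Fin.rev = J := by
  constructor
  · intro hp
    have upper : ∀ i j : Fin (N + 1), i ≤ j → J i.rev j.rev = J i j := by
      intro i j hij
      rcases hij.eq_or_lt with rfl | hlt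
      · exact (hp.diag i).symm
      by_cases h : (i : ℕ) + 1 < j
      · rw [hJ.tridiagonal i j h, ← hJ.symm.apply]
        exact hJ.tridiagonal _ _ (by rw [Fin.val_rev, Fin.val_rev]; omega)
      · have hiN : (i : ℕ) < N := by omega
        obtain ⟨l, rfl, rfl⟩ : ∃ l : Fin N, i = l.castSucc ∧ j = l.succ :=
          ⟨⟨i, hiN⟩, rfl, Fin.ext (by
            have := Fin.lt_def.mp hlt
            simp only [Fin.val_succ]; omega)⟩
        rw [hp.offDiag l, Fin.rev_castSucc, Fin.rev_succ, hJ.symm.apply]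
    ext i j
    rw [Matrix.submatrix_apply]
    rcases le_total i j with h | h
    · exact upper i j h
    · rw [← hJ.symm.apply, ← hJ.symm.apply i j]
      exact upper j i h
  · intro h
    refine ⟨fun k => ?_, fun l => ?_⟩
    · exact (congrFun (congrFun h k) k).symm
    · rw [← hJ.symm.apply l.rev.castSucc, ← Fin.rev_castSucc, ← Fin.rev_succ]
      exact (congrFun (congrFun h l.castSucc) l.succ).symm

theorem prod_erase_sub_ne_zero {ι : Type*} [Fintype ι] [DecidableEq ι] {lam : ι → ℝ}
    (hlam : Function.Injective lam) (k : ι) : ∏ l ∈ Finset.univ.erase k, (lam k - lam l) ≠ 0 :=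
  Finset.prod_ne_zero_iff.mpr fun _ hl =>
    sub_ne_zero.mpr fun e => (Finset.ne_of_mem_erase hl) (hlam e).symm

/-- Exactly the `N - k` indices above `k` contribute negative factors. -/
theorem prod_erase_sub_mul_neg_one_pow_pos {N : ℕ} {lam : Fin (N + 1) → ℝ}
    (hlam : StrictMono lam) (k : Fin (N + 1)) :
    0 < (∏ l ∈ Finset.univ.erase k, (lam k - lam l)) * (-1) ^ (N - (k : ℕ)) := by
  have hu : Finset.univ.erase k = Finset.Iio k ∪ Finset.Ioi k := by
    ext l; simp [lt_or_lt_iff_ne]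
  have hd : Disjoint (Finset.Iio k) (Finset.Ioi k) := by
    rw [Finset.disjoint_left]
    intro l h1 h2
    exact absurd (Finset.mem_Iio.mp h1) (Finset.mem_Ioi.mp h2).not_gt
  have hc : (-1 : ℝ) ^ (N - (k : ℕ)) = ∏ _l ∈ Finset.Ioi k, (-1 : ℝ) := by
    rw [Finset.prod_const, Fin.card_Ioi]
    congr 1
  rw [hu, Finset.prod_union hd, hc, mul_assoc, ← Finset.prod_mul_distrib]
  refine mul_pos (Finset.prod_pos fun l hl => ?_) (Finset.prod_pos fun l hl => ?_)
  · exact sub_pos.mpr (hlam (Finset.mem_Iio.mp hl))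
  · have := hlam (Finset.mem_Ioi.mp hl)
    linarith

section Persymmetric

variable {N : ℕ} {J Q : Matrix (Fin (N + 1)) (Fin (N + 1)) ℝ} {lam : Fin (N + 1) → ℝ}

theorem IsJacobi.pow_last_zero_pos (hJ : IsJacobi J) : 0 < (J ^ N) (Fin.last N) 0 :=
  hJ.pow_apply_zero_pos N _ rfl

theorem IsSpectralDecomposition.sq_last_eq (h : IsSpectralDecomposition J lam Q)
    (hJ : IsJacobi J) (hp : IsPersymmetric J) (hlam : Function.Injective lam) (k : Fin (N + 1)) :
    Q k (Fin.last N) ^ 2 = Q k 0 ^ 2 := by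
  refine h.sq_eq_of_moments hlam (fun d => ?_) k
  have h' := h.submatrix_rev
  rw [hJ.isPersymmetric_iff.mp hp] at h'
  rw [h.pow_apply, h'.pow_apply]
  simp

/-- The spectral weights of a persymmetric Jacobi matrix. -/
theorem IsSpectralDecomposition.sq_mul_abs_prod (h : IsSpectralDecomposition J lam Q)
    (hJ : IsJacobi J) (hp : IsPersymmetric J) (hlam : Function.Injective lam) (k : Fin (N + 1)) :
    Q k 0 ^ 2 * |∏ l ∈ Finset.univ.erase k, (lam k - lam l)| = (J ^ N) (Fin.last N) 0 := by
  have h1 := congrArg abs (h.mul_last_mul_prod hJ k)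
  rw [abs_mul, abs_mul, abs_of_pos hJ.pow_last_zero_pos,
    sq_eq_sq_iff_abs_eq_abs _ _ |>.mp (h.sq_last_eq hJ hp hlam k), ← sq, sq_abs] at h1
  exact h1

theorem IsSpectralDecomposition.apply_zero_ne_zero (h : IsSpectralDecomposition J lam Q)
    (hJ : IsJacobi J) (k : Fin (N + 1)) : Q k 0 ≠ 0 := by
  intro h0
  have := h.mul_last_mul_prod hJ k
  rw [h0, mul_zero, zero_mul] at this
  exact hJ.pow_last_zero_pos.ne this

/-- The eigenvectors of a persymmetric Jacobi matrix are alternately even and odd. -/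
theorem IsSpectralDecomposition.apply_last (h : IsSpectralDecomposition J lam Q)
    (hJ : IsJacobi J) (hp : IsPersymmetric J) (hlam : StrictMono lam) (k : Fin (N + 1)) :
    Q k (Fin.last N) = (-1) ^ (N - (k : ℕ)) * Q k 0 := by
  have hD := prod_erase_sub_mul_neg_one_pow_pos hlam k
  have hB := h.mul_last_mul_prod hJ k ▸ hJ.pow_last_zero_pos
  have hs := h.sq_last_eq hJ hp hlam.injective k
  set s : ℝ := (-1) ^ (N - (k : ℕ)) with hsdef
  have hs1 : s * s = 1 := by rw [hsdef, ← mul_pow]; simp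
  have hpos : 0 < Q k (Fin.last N) * (s * Q k 0) := by
    have h1 := mul_pos hB hD
    set D := ∏ l ∈ Finset.univ.erase k, (lam k - lam l)
    have h2 : 0 < Q k (Fin.last N) * (s * Q k 0) * D ^ 2 := by
      calc 0 < _ := h1
        _ = _ := by ring
    exact pos_of_mul_pos_left h2 (sq_nonneg D)
  have hsq : Q k (Fin.last N) ^ 2 = (s * Q k 0) ^ 2 := by
    rw [hs, mul_pow, sq s, hs1, one_mul]
  rcases sq_eq_sq_iff_eq_or_eq_neg.mp hsq with h1 | h1
  · exact h1
  · rw [h1] at hpos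
    nlinarith [sq_nonneg (s * Q k 0)]

theorem IsJacobi.eq_of_spectralDecomposition {J' Q' : Matrix (Fin (N + 1)) (Fin (N + 1)) ℝ}
    (hJ : IsJacobi J) (hJ' : IsJacobi J') (h : IsSpectralDecomposition J lam Q)
    (h' : IsSpectralDecomposition J' lam Q') (hw : ∀ k, Q k 0 ^ 2 = Q' k 0 ^ 2) : J = J' := by
  refine hJ.eq_of_moments hJ' fun d => ?_
  rw [h.pow_apply, h'.pow_apply]
  exact Finset.sum_congr rfl fun k _ => by rw [← sq, ← sq, hw]

/-- A persymmetric Jacobi matrix is determined by its spectrum. -/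
theorem IsJacobi.eq_of_isPersymmetric {J' Q' : Matrix (Fin (N + 1)) (Fin (N + 1)) ℝ}
    (hJ : IsJacobi J) (hJ' : IsJacobi J') (hp : IsPersymmetric J) (hp' : IsPersymmetric J')
    (hlam : Function.Injective lam) (h : IsSpectralDecomposition J lam Q)
    (h' : IsSpectralDecomposition J' lam Q') : J = J' := by
  set D : Fin (N + 1) → ℝ := fun k => |∏ l ∈ Finset.univ.erase k, (lam k - lam l)| with hD
  have hDpos : ∀ k, 0 < D k := fun k => abs_pos.mpr (prod_erase_sub_ne_zero hlam k)
  have hw : ∀ k, Q k 0 ^ 2 = (J ^ N) (Fin.last N) 0 * (D k)⁻¹ := fun k => by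
    rw [← h.sq_mul_abs_prod hJ hp hlam k, mul_inv_cancel_right₀ (hDpos k).ne']
  have hw' : ∀ k, Q' k 0 ^ 2 = (J' ^ N) (Fin.last N) 0 * (D k)⁻¹ := fun k => by
    rw [← h'.sq_mul_abs_prod hJ' hp' hlam k, mul_inv_cancel_right₀ (hDpos k).ne']
  have hS : (∑ k, (D k)⁻¹) ≠ 0 :=
    (Finset.sum_pos (fun k _ => inv_pos.mpr (hDpos k)) Finset.univ_nonempty).ne'
  have hB : (J ^ N) (Fin.last N) 0 = (J' ^ N) (Fin.last N) 0 := by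
    have h1 := h.sum_sq 0
    have h2 := h'.sum_sq 0
    simp_rw [hw, ← Finset.mul_sum] at h1
    simp_rw [hw', ← Finset.mul_sum] at h2
    exact mul_right_cancel₀ hS (h1.trans h2.symm)
  exact hJ.eq_of_spectralDecomposition hJ' h h' fun k => by rw [hw, hw', hB]

/-- Existence of a persymmetric Jacobi matrix with a given simple spectrum. -/
theorem exists_isJacobi_isPersymmetric (hlam : Function.Injective lam) :
    ∃ J Q, IsJacobi J ∧ IsPersymmetric J ∧ IsSpectralDecomposition J lam Q := by
  set D : Fin (N + 1) → ℝ := fun k => |∏ l ∈ Finset.univ.erase k, (lam k - lam l)| with hD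
  have hDpos : ∀ k, 0 < D k := fun k => abs_pos.mpr (prod_erase_sub_ne_zero hlam k)
  set S : ℝ := ∑ k, (D k)⁻¹ with hSdef
  have hS : 0 < S := Finset.sum_pos (fun k _ => inv_pos.mpr (hDpos k)) Finset.univ_nonempty
  obtain ⟨J, Q, hJ, h, hw⟩ := exists_isJacobi_of_weights lam hlam (fun k => S⁻¹ * (D k)⁻¹)
    (fun k => mul_pos (inv_pos.mpr hS) (inv_pos.mpr (hDpos k)))
    (by rw [← Finset.mul_sum]; exact inv_mul_cancel₀ hS.ne')
  refine ⟨J, Q, hJ, hJ.isPersymmetric_iff.mpr ?_, h⟩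
  set B := (J ^ N) (Fin.last N) 0
  -- The product formula for the end components makes the weights at `e_N` proportional to those at
  -- `e₀`. Both families sum to `1`, so they coincide, and `J` equals its reversal.
  have hlast : ∀ k, Q k (Fin.last N) ^ 2 = B ^ 2 * S * (D k)⁻¹ := by
    intro k
    have h1 : Q k (Fin.last N) ^ 2 * Q k 0 ^ 2 * D k ^ 2 = B ^ 2 := by
      rw [hD, sq_abs, ← mul_pow, ← mul_pow, h.mul_last_mul_prod hJ k]
    rw [hw] at h1
    rw [← h1]
    have := (hDpos k).ne'
    field_simp
  have hBS : B ^ 2 * S = S⁻¹ := by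
    have h1 := h.sum_sq (Fin.last N)
    simp_rw [hlast, ← Finset.mul_sum] at h1
    exact eq_inv_of_mul_eq_one_left h1
  refine hJ.submatrix_rev.eq_of_spectralDecomposition hJ h.submatrix_rev h fun k => ?_
  rw [Matrix.submatrix_apply, Fin.rev_zero, id, hlast, hw, hBS]

end Persymmetric

/-! ### The middle-gap spectrum -/

/-- The spectrum symmetric about `0` with unit gaps except for the middle gap `2 * m + 1`. -/
noncomputable def middleGapEigenvalue (n m N : ℕ) (k : Fin (N + 1)) : ℝ :=
  if (k : ℕ) < n then (k : ℝ) - N / 2 - m else (k : ℝ) - N / 2 + m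

theorem middleGapEigenvalue_succ_sub {n m N : ℕ} (k : Fin N) :
    middleGapEigenvalue n m N k.succ - middleGapEigenvalue n m N k.castSucc
      = if (k : ℕ) + 1 = n then 2 * (m : ℝ) + 1 else 1 := by
  simp only [middleGapEigenvalue, Fin.val_succ, Fin.val_castSucc]
  split_ifs <;> first | omega | (push_cast; ring)

theorem middleGapEigenvalue_strictMono {n m N : ℕ} :
    StrictMono (middleGapEigenvalue n m N) := by
  rw [Fin.strictMono_iff_lt_succ]
  intro k
  rw [← sub_pos, middleGapEigenvalue_succ_sub]
  split_ifs <;> positivity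

theorem middleGapEigenvalue_rev {n m N : ℕ} (hN : N + 1 = 2 * n) (k : Fin (N + 1)) :
    middleGapEigenvalue n m N k.rev = -middleGapEigenvalue n m N k := by
  have hk : (k : ℕ) ≤ N := Nat.le_of_lt_succ k.2
  have hr : ((k.rev : ℕ) : ℝ) = N - (k : ℕ) := by
    rw [Fin.val_rev, Nat.add_sub_add_right, Nat.cast_sub hk]
  simp only [middleGapEigenvalue]
  rw [hr]
  have : (k.rev : ℕ) = N - k := by rw [Fin.val_rev, Nat.add_sub_add_right]
  split_ifs <;> first | omega | ring

theorem eq_middleGapEigenvalue {n m N : ℕ} (hN : N + 1 = 2 * n)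
    {lam : Fin (N + 1) → ℝ} (hsymm : ∀ k, lam k.rev = -lam k)
    (hgap : ∀ k : Fin N, lam k.succ - lam k.castSucc
      = if (k : ℕ) + 1 = n then 2 * (m : ℝ) + 1 else 1) : lam = middleGapEigenvalue n m N := by
  have hc : ∀ k, lam k - middleGapEigenvalue n m N k = lam 0 - middleGapEigenvalue n m N 0 := by
    intro k
    induction k using Fin.induction with
    | zero => rfl
    | succ k ih =>
      have h1 := hgap k
      have h2 := middleGapEigenvalue_succ_sub (n := n) (m := m) k
      linarith
  -- The gaps fix the spectrum up to a translation; symmetry about `0` forces the translation to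
  -- vanish.
  have h0 := hc (Fin.rev 0)
  rw [hsymm, middleGapEigenvalue_rev hN] at h0
  ext k
  linarith [hc k]

/-- `exp (-iπλ_k)` alternates in sign. -/
theorem exp_neg_pi_mul_middleGapEigenvalue {n m N : ℕ} (k : Fin (N + 1)) :
    Complex.exp (-(Complex.I * Real.pi) * middleGapEigenvalue n m N k)
      = (-1) ^ ((k : ℕ) + m) * Complex.exp (Complex.I * (Real.pi * N / 2 : ℝ)) := by
  have hneg : ∀ j : ℕ, Complex.exp (-(Real.pi * Complex.I * j)) = (-1) ^ j := by
    intro j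
    rw [Complex.exp_neg, mul_comm, Complex.exp_nat_mul, Complex.exp_pi_mul_I, ← inv_pow]
    norm_num
  have hpos : ∀ j : ℕ, Complex.exp (Real.pi * Complex.I * j) = (-1) ^ j := by
    intro j
    rw [mul_comm, Complex.exp_nat_mul, Complex.exp_pi_mul_I]
  -- The shifts by `-m` and `+m` give the same sign `(-1) ^ m`, so the odd middle gap does not break
  -- the alternation.
  unfold middleGapEigenvalue
  split_ifs
  · rw [pow_add, ← hneg k, ← hpos m, ← Complex.exp_add, ← Complex.exp_add]
    congr 1
    push_cast
    ring
  · rw [pow_add, ← hneg k, ← hneg m, ← Complex.exp_add, ← Complex.exp_add]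
    congr 1
    push_cast
    ring

/-- Since `N / 2 = n - 1/2`, every eigenvalue is `±(l + 1/2)`, where `l` is `m` plus the distance of
`k` from the nearer middle index. The wide gap thus pushes every frequency to at least `m + 1/2`. -/
theorem cos_middleGapEigenvalue_mul {n m N : ℕ} (hN : N + 1 = 2 * n) (k : Fin (N + 1)) :
    ∃ l : ℕ, m ≤ l ∧ ∀ t : ℝ,
      Real.cos (middleGapEigenvalue n m N k * t) = Real.cos ((l + 1 / 2) * t) := by
  have hN' : (N : ℝ) = 2 * n - 1 := by
    have : ((N + 1 : ℕ) : ℝ) = (2 * n : ℕ) := by rw [hN]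
    push_cast at this
    linarith
  unfold middleGapEigenvalue
  split_ifs with h
  · refine ⟨n - 1 - k + m, by omega, fun t => ?_⟩
    have : ((n - 1 - k + m : ℕ) : ℝ) = n - 1 - k + m := by
      rw [Nat.cast_add, Nat.cast_sub (by omega), Nat.cast_sub (by omega), Nat.cast_one]
    rw [this, ← Real.cos_neg, hN']
    ring_nf
  · refine ⟨k - n + m, by omega, fun t => ?_⟩
    have : ((k - n + m : ℕ) : ℝ) = k - n + m := by
      rw [Nat.cast_add, Nat.cast_sub (by omega)]
    rw [this, hN']
    ring_nf

/-! ### Perfect state transfer and the return amplitude -/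

section Transfer

variable {n m N : ℕ} {J Q : Matrix (Fin (N + 1)) (Fin (N + 1)) ℝ}

theorem realizesPSTAt_pi (hJ : IsJacobi J)
    (hp : IsPersymmetric J) (h : IsSpectralDecomposition J (middleGapEigenvalue n m N) Q) :
    RealizesPSTAt J Real.pi := by
  -- The extra multiple of `π` supplies the sign `(-1) ^ (m + N)` relating `(-1) ^ (k + m)` to `(-1)
  -- ^ (N - k)`.
  refine ⟨Real.pi_pos, Real.pi * N / 2 + (m + N : ℕ) * Real.pi, ?_⟩
  have hphase : Complex.exp (Complex.I * ((Real.pi * N / 2 + (m + N : ℕ) * Real.pi : ℝ) : ℂ))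
      = (-1) ^ (m + N) * Complex.exp (Complex.I * (Real.pi * N / 2 : ℝ)) := by
    rw [← Complex.exp_pi_mul_I, ← Complex.exp_nat_mul, ← Complex.exp_add]
    congr 1
    push_cast
    ring
  have hterm : ∀ k, (Q k 0 : ℂ) * Complex.exp
      (-(Complex.I * Real.pi) * middleGapEigenvalue n m N k)
      = (-1) ^ (m + N) * Complex.exp (Complex.I * (Real.pi * N / 2 : ℝ)) * Q k (Fin.last N) := by
    intro k
    rw [exp_neg_pi_mul_middleGapEigenvalue,
      h.apply_last hJ hp middleGapEigenvalue_strictMono k]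
    have hsign : (-1 : ℂ) ^ (m + N) * (-1) ^ (N - (k : ℕ)) = (-1) ^ ((k : ℕ) + m) := by
      have hk : (k : ℕ) ≤ N := Nat.le_of_lt_succ k.2
      have : m + N + (N - (k : ℕ)) = (k : ℕ) + m + 2 * (N - k) := by omega
      rw [← pow_add, this, pow_add _ _ (2 * _), pow_mul]
      simp
    push_cast
    rw [← hsign]
    ring
  ext i
  rw [h.evolvedState_apply, Pi.smul_apply, smul_eq_mul, hphase]
  simp_rw [mul_assoc, hterm]
  have horth : ∑ k, (Q k i : ℂ) * Q k (Fin.last N)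
      = (Pi.single (Fin.last N) 1 : Fin (N + 1) → ℂ) i := by
    have := congrFun (congrFun h.orthogonal i) (Fin.last N)
    simp only [Matrix.mul_apply, Matrix.one_apply, Matrix.transpose_apply] at this
    have := congrArg Complex.ofReal this
    rw [Pi.single_apply]
    rw [apply_ite Complex.ofReal] at this
    push_cast at this
    exact this
  rw [← horth, ← mul_assoc, Finset.mul_sum]
  exact Finset.sum_congr rfl fun k _ => by ring

/-- At a time of perfect state transfer every phase `exp (-iTλ_k)` carries the `0`-th component of
the eigenvector to its last component. -/
theorem IsSpectralDecomposition.exp_mul_apply_zero {lam : Fin (N + 1) → ℝ}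
    (h : IsSpectralDecomposition J lam Q) {T φ : ℝ}
    (hT : evolvedState J T =
      Complex.exp (Complex.I * (φ : ℂ)) • (Pi.single (Fin.last N) 1 : Fin (N + 1) → ℂ))
    (k : Fin (N + 1)) :
    Complex.exp (-(Complex.I * T) * lam k) * Q k 0
      = Complex.exp (Complex.I * φ) * Q k (Fin.last N) := by
  -- Pairing with the `k`-th eigenvector isolates its phase.
  have h1 : ∑ i, (Q k i : ℂ) * evolvedState J T i
      = Complex.exp (-(Complex.I * T) * lam k) * Q k 0 := by
    simp_rw [h.evolvedState_apply, Finset.mul_sum]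
    rw [Finset.sum_comm]
    have horth : ∀ l, ∑ i, (Q k i : ℂ) * Q l i = if k = l then 1 else 0 := by
      intro l
      have := congrFun (congrFun h.orthogonal' k) l
      simp only [Matrix.mul_apply, Matrix.one_apply, Matrix.transpose_apply] at this
      have := congrArg Complex.ofReal this
      rw [apply_ite Complex.ofReal] at this
      push_cast at this
      exact this
    have : ∀ l, ∑ i, (Q k i : ℂ) * ((Q l i : ℂ) * Q l 0 * Complex.exp (-(Complex.I * T) * lam l))
        = (if k = l then 1 else 0) * (Complex.exp (-(Complex.I * T) * lam l) * Q l 0) := by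
      intro l
      rw [← horth, Finset.sum_mul]
      exact Finset.sum_congr rfl fun i _ => by ring
    simp_rw [this]
    simp
  rw [← h1, hT]
  simp [Pi.single_apply, mul_comm]

theorem pi_le_of_realizesPSTAt (hn : 1 < n) (hN : N + 1 = 2 * n) (hJ : IsJacobi J)
    (hp : IsPersymmetric J) (h : IsSpectralDecomposition J (middleGapEigenvalue n m N) Q)
    {T : ℝ} (hT : RealizesPSTAt J T) : Real.pi ≤ T := by
  obtain ⟨hT0, φ, hφ⟩ := hT
  have hmono := middleGapEigenvalue_strictMono (n := n) (m := m) (N := N)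
  have hN0 : 0 < N := by omega
  -- As `n > 1`, the lowest gap is not the middle one, so it equals `1`; the opposite parities of
  -- the two eigenvectors then give `exp (-iT) = -1`.
  let k : Fin N := ⟨0, hN0⟩
  have e0 := h.exp_mul_apply_zero hφ k.castSucc
  have e1 := h.exp_mul_apply_zero hφ k.succ
  rw [h.apply_last hJ hp hmono] at e0 e1
  have q0 : (Q k.castSucc 0 : ℂ) ≠ 0 := Complex.ofReal_ne_zero.mpr (h.apply_zero_ne_zero hJ _)
  have q1 : (Q k.succ 0 : ℂ) ≠ 0 := Complex.ofReal_ne_zero.mpr (h.apply_zero_ne_zero hJ _)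
  push_cast at e0 e1
  rw [← mul_assoc] at e0 e1
  replace e0 := mul_right_cancel₀ q0 e0
  replace e1 := mul_right_cancel₀ q1 e1
  have hpow : (-1 : ℂ) ^ (N - (k.castSucc : ℕ)) = -(-1) ^ (N - (k.succ : ℕ)) := by
    have : N - (k.castSucc : ℕ) = N - (k.succ : ℕ) + 1 := by
      simp only [Fin.val_castSucc, Fin.val_succ, k]; omega
    rw [this, pow_succ]; ring
  have hgap : middleGapEigenvalue n m N k.succ = middleGapEigenvalue n m N k.castSucc + 1 := by
    have := middleGapEigenvalue_succ_sub (n := n) (m := m) k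
    rw [if_neg (by simp only [k]; omega)] at this
    linarith
  rw [hpow, mul_neg, ← e1, hgap] at e0
  have hexp : Complex.exp (-(T * Complex.I)) = -1 := by
    have h2 : Complex.exp (-(Complex.I * T) * (middleGapEigenvalue n m N k.castSucc + 1 : ℝ))
        = Complex.exp (-(Complex.I * T) * middleGapEigenvalue n m N k.castSucc)
          * Complex.exp (-(T * Complex.I)) := by
      rw [← Complex.exp_add]
      congr 1
      push_cast
      ring
    rw [h2] at e0
    have hne := Complex.exp_ne_zero (-(Complex.I * T) * middleGapEigenvalue n m N k.castSucc)
    refine mul_left_cancel₀ hne ?_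
    linear_combination e0
  have hcos : Real.cos T = -1 := by
    have h3 := congrArg Complex.re hexp
    rw [← neg_mul, ← Complex.ofReal_neg, Complex.exp_ofReal_mul_I_re, Real.cos_neg] at h3
    simpa using h3
  by_contra! hlt
  have := Real.cos_lt_cos_of_nonneg_of_le_pi hT0.le le_rfl hlt
  rw [Real.cos_pi, hcos] at this
  exact lt_irrefl _ this

/-- The spectral weights inherit the symmetry of the spectrum. -/
theorem IsSpectralDecomposition.sq_apply_zero_rev {lam : Fin (N + 1) → ℝ}
    (h : IsSpectralDecomposition J lam Q) (hJ : IsJacobi J) (hp : IsPersymmetric J)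
    (hlam : Function.Injective lam) (hsymm : ∀ k, lam k.rev = -lam k) (k : Fin (N + 1)) :
    Q k.rev 0 ^ 2 = Q k 0 ^ 2 := by
  have h1 := h.sq_mul_abs_prod hJ hp hlam k
  have h2 := h.sq_mul_abs_prod hJ hp hlam k.rev
  have hD : |∏ l ∈ Finset.univ.erase k.rev, (lam k.rev - lam l)|
      = |∏ l ∈ Finset.univ.erase k, (lam k - lam l)| := by
    rw [Finset.abs_prod, Finset.abs_prod]
    refine Finset.prod_bij' (fun l _ => l.rev) (fun l _ => l.rev) ?_ ?_ ?_ ?_ ?_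
    · intro l hl
      simpa [Fin.rev_eq_iff] using hl
    · intro l hl
      simpa [Fin.rev_inj] using hl
    · simp
    · simp
    · intro l _
      rw [hsymm, hsymm, ← abs_neg]
      congr 1
      ring
  rw [hD, ← h1] at h2
  exact mul_right_cancel₀ (abs_ne_zero.mpr (prod_erase_sub_ne_zero hlam k)) h2

/-- The weights are even under `λ ↦ -λ`, so the sine terms cancel in pairs and the amplitude is
real. -/
theorem IsSpectralDecomposition.returnAmplitude_eq {lam : Fin (N + 1) → ℝ}
    (h : IsSpectralDecomposition J lam Q) (hJ : IsJacobi J) (hp : IsPersymmetric J)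
    (hlam : Function.Injective lam) (hsymm : ∀ k, lam k.rev = -lam k) (t : ℝ) :
    returnAmplitude J t = ((∑ k, Q k 0 ^ 2 * Real.cos (lam k * t) : ℝ) : ℂ) := by
  have hterm : ∀ k, (Q k 0 : ℂ) * Q k 0 * Complex.exp (-(Complex.I * t) * lam k)
      = ((Q k 0 ^ 2 * Real.cos (lam k * t) : ℝ) : ℂ)
        - Complex.I * ((Q k 0 ^ 2 * Real.sin (lam k * t) : ℝ) : ℂ) := by
    intro k
    have : -(Complex.I * (t : ℂ)) * lam k = ((-(lam k * t) : ℝ) : ℂ) * Complex.I := by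
      push_cast; ring
    rw [this, Complex.exp_mul_I, ← Complex.ofReal_cos, ← Complex.ofReal_sin, Real.cos_neg,
      Real.sin_neg]
    push_cast
    ring
  have hsin : ∑ k, Q k 0 ^ 2 * Real.sin (lam k * t) = 0 := by
    have : ∑ k, Q k 0 ^ 2 * Real.sin (lam k * t) = -∑ k, Q k 0 ^ 2 * Real.sin (lam k * t) := by
      conv_lhs => rw [← Equiv.sum_comp Fin.revPerm]
      rw [← Finset.sum_neg_distrib]
      refine Finset.sum_congr rfl fun k _ => ?_
      rw [Fin.revPerm_apply, h.sq_apply_zero_rev hJ hp hlam hsymm, hsymm, neg_mul, Real.sin_neg,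
        mul_neg]
    linarith
  rw [returnAmplitude, h.evolvedState_apply]
  simp_rw [hterm]
  rw [Finset.sum_sub_distrib, ← Finset.mul_sum, ← Complex.ofReal_sum, ← Complex.ofReal_sum, hsin]
  simp

end Transfer

theorem mainTheorem2 (n m N : ℕ) (hn : 1 < n) (hm : 0 < m) (hN : N = 2 * n - 1) :
    ∃ J : Matrix (Fin (N + 1)) (Fin (N + 1)) ℝ,
      (IsJacobi J ∧ IsPersymmetric J ∧ HasMiddleGapSpectrum n m J) ∧
      (∀ J' : Matrix (Fin (N + 1)) (Fin (N + 1)) ℝ,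
        IsJacobi J' → IsPersymmetric J' → HasMiddleGapSpectrum n m J' → J' = J) ∧
      IsEarliestPST J Real.pi ∧
      ∃ t : Fin m → ℝ, Function.Injective t ∧ ∀ j : Fin m, HasESEAt J (t j) := by
  have hN' : N + 1 = 2 * n := by omega
  have hinj := (middleGapEigenvalue_strictMono (n := n) (m := m) (N := N)).injective
  have hsymm := middleGapEigenvalue_rev (m := m) hN'
  obtain ⟨J, Q, hJ, hp, h⟩ := exists_isJacobi_isPersymmetric hinj
  have hPST : IsEarliestPST J Real.pi :=
    ⟨realizesPSTAt_pi hJ hp h, fun T hT => pi_le_of_realizesPSTAt hn hN' hJ hp h hT⟩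
  refine ⟨J, ⟨hJ, hp, _, h.spectrum_eq, hsymm, middleGapEigenvalue_succ_sub⟩, ?_, hPST, ?_⟩
  · rintro J' hJ' hp' ⟨lam, hs, hrev, hgap⟩
    obtain rfl := eq_middleGapEigenvalue hN' hrev hgap
    obtain ⟨Q', h'⟩ := exists_isSpectralDecomposition hJ'.symm hinj hs
    exact hJ'.eq_of_isPersymmetric hJ hp' hp hinj h' h
  · choose l hl hcos using fun k => cos_middleGapEigenvalue_mul (m := m) hN' k
    obtain ⟨t, ht, hz⟩ := exists_zeros_sum_cos_half (fun k => Q k 0 ^ 2)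
      (fun k => sq_pos_of_ne_zero (h.apply_zero_ne_zero hJ k)) l m hl
    refine ⟨t, ht, fun j => ⟨Real.pi, hPST, (hz j).1, (hz j).2.1, ?_⟩⟩
    rw [h.returnAmplitude_eq hJ hp hinj hsymm]
    simp_rw [hcos]
    rw [(hz j).2.2, Complex.ofReal_zero]
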